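/- Let $a_{40},a_{22},a_{04}\ge 0$ be real numbers with $a_{40}+a_{22}>0$ and $a_{22}+a_{04}>0$. For $t\in\mathbb R$ put $$W_t(x,y)=\exp\bigl(-(a_{40}x^4+a_{22}x^2y^2+a_{04}y^4)+t(x^2+y^2)\bigr),\qquad (f,g)_t=\iint_{\mathbb R^2} f\,g\,W_t\,dx\,dy .$$ Let $T=\mathbb R$ if $a_{40}>0$ and $a_{04}>0$, and $T=(-\infty,0)$ otherwise. For $n\ge 0$ let $L_{n,1}=(I_{n+1}\,|\,0)$ and $L_{n,2}=(0\,|\,I_{n+1})$, matrices of size $(n+1)\times(n+2)$. For every $t\in T$ all moments $\iint x^hy^kW_t\,dx\,dy$ are finite. Moreover, there is exactly one monic orthogonal system $\{\mathbb Q_n(t)\}_{n\ge0}$ for $(\cdot,\cdot)_t$: column vectors $\mathbb Q_n=(Q_{n,0},\dots,Q_{n,n})^T$ of real polynomials in $x,y$, where $Q_{n,k}$ is $x^{n-k}y^k$ plus a polynomial of total degree less than $n$, such that $(Q_{n,k},Q_{m,l})_t=0$ for all $k,l$ whenever $n\ne m$. Finally, there are unique real matrices $E_{n,1}(t),E_{n,2}(t)$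 of size $(n+1)\times n$ with $$x\,\mathbb Q_n=L_{n,1}\mathbb Q_{n+1}+E_{n,1}\mathbb Q_{n-1},\qquad y\,\mathbb Q_n=L_{n,2}\mathbb Q_{n+1}+E_{n,2}\mathbb Q_{n-1}\qquad(n\ge 0,\ \mathbb Q_{-1}=0).$$ Put $\mathbf E_n=E_{n,1}+E_{n,2}$ for $n\ge1$ and, for $n\ge 0$, $$V_{n+1}=L_{n,1}E_{n+1,1}+L_{n,2}E_{n+1,2}+E_{n,1}L_{n-1,1}+E_{n,2}L_{n-1,2},$$ where the last two terms are zero for $n=0$. Then for every $n\ge1$ the matrix function $\mathbf E_n$ is differentiable on $T$, and $$\frac{d}{dt}\mathbf E_n(t)=V_{n+1}(t)\,\mathbf E_n(t)-\mathbf E_n(t)\,V_n(t)\qquad(t\in T).$$ -/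

import Mathlib

open MeasureTheory

noncomputable section

namespace Freud

/-- Real polynomials in two variables; variable `0` is `x`, variable `1` is `y`. -/
abbrev Poly2 := MvPolynomial (Fin 2) ℝ

/-- The weight `W_t(x,y) = exp(-(a₄₀x⁴ + a₂₂x²y² + a₀₄y⁴) + t(x² + y²))`. -/
def weight (a40 a22 a04 t : ℝ) (z : ℝ × ℝ) : ℝ :=
  Real.exp (-(a40 * z.1 ^ 4 + a22 * z.1 ^ 2 * z.2 ^ 2 + a04 * z.2 ^ 4) + t * (z.1 ^ 2 + z.2 ^ 2))

/-- The times at which `W_t` is a weight with finite moments: all of `ℝ` if `a₄₀, a₀₄ > 0`. If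
one of these coefficients vanishes, `W_t` does not decay along an axis unless `t < 0`, and then
the times are the negative ones. -/
def times (a40 a04 : ℝ) : Set ℝ := {t | (0 < a40 ∧ 0 < a04) ∨ t < 0}

/-- The inner product `(f, g) = ∬ f g W dx dy` attached to a function `W` on the plane. -/
def innerProd (W : ℝ × ℝ → ℝ) (f g : Poly2) : ℝ :=
  ∫ z : ℝ × ℝ, MvPolynomial.eval ![z.1, z.2] f * MvPolynomial.eval ![z.1, z.2] g * W z

/-- A sequence of column vectors of polynomials, the `n`-th one of size `n + 1`. -/
abbrev VecSeq := (n : ℕ) → Fin (n + 1) → Poly2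

/-- A polynomial system: the entries of `P n` have total degree exactly `n` and are linearly
independent. -/
def IsPolynomialSystem (P : VecSeq) : Prop :=
  ∀ n, (∀ r, P n r ≠ 0 ∧ (P n r).totalDegree = n) ∧ LinearIndependent ℝ (P n)

/-- The leading matrix `G_n`: the entry `(r, k)` is the coefficient of `x^(n-k) y^k` in the `r`-th
entry of `P n`. -/
def leadingMatrix (P : VecSeq) (n : ℕ) : Matrix (Fin (n + 1)) (Fin (n + 1)) ℝ :=
  Matrix.of fun r k =>
    MvPolynomial.coeff (Finsupp.single 0 (n - (k : ℕ)) + Finsupp.single 1 (k : ℕ)) (P n r)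

/-- `Q` is a monic polynomial system, orthogonal with respect to `W`: `(Q_n, Q_mᵀ) = 0` for
`n ≠ m`, and `G_n` is the identity matrix. -/
structure IsMonicOrthogonalSystem (W : ℝ × ℝ → ℝ) (Q : VecSeq) : Prop where
  system : IsPolynomialSystem Q
  monic : ∀ n, leadingMatrix Q n = 1
  orthogonal : ∀ n m, n ≠ m → ∀ r k, innerProd W (Q n r) (Q m k) = 0

/-- The `m × (m + 1)` matrix `L_{m-1,i}`, that is `(I | 0)` for the first variable (`i = 0`) and
`(0 | I)` for the second one (`i = 1`). So `L_{n,1}, L_{n,2}` are `L (n + 1) 0, L (n + 1) 1`. -/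
def L (m : ℕ) (i : Fin 2) : Matrix (Fin m) (Fin (m + 1)) ℝ :=
  Matrix.of fun r k => if (k : ℕ) = (r : ℕ) + (i : ℕ) then 1 else 0

/-- The vector `Q_{n-1}`, of size `n`; it is empty for `n = 0`. -/
def prev (Q : VecSeq) : (n : ℕ) → Fin n → Poly2
  | 0 => Fin.elim0
  | n + 1 => Q n

/-- A family of matrices `E_{n,i}` of size `(n + 1) × n`; `E n 0` is `E_{n,1}` and `E n 1` is
`E_{n,2}`. -/
abbrev CoeffSeq := (n : ℕ) → Fin 2 → Matrix (Fin (n + 1)) (Fin n) ℝ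

/-- The three term relations `x Q_n = L_{n,1} Q_{n+1} + E_{n,1} Q_{n-1}` and
`y Q_n = L_{n,2} Q_{n+1} + E_{n,2} Q_{n-1}` for all `n ≥ 0`, where `Q_{-1} = 0`. -/
def IsThreeTerm (Q : VecSeq) (E : CoeffSeq) : Prop :=
  ∀ (n : ℕ) (i : Fin 2),
    (fun r => MvPolynomial.X i * Q n r) =
      ((L (n + 1) i).map MvPolynomial.C).mulVec (Q (n + 1)) +
        ((E n i).map MvPolynomial.C).mulVec (prev Q n)

/-- `𝐄_n = E_{n,1} + E_{n,2}`. -/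
def sumE (E : CoeffSeq) (n : ℕ) : Matrix (Fin (n + 1)) (Fin n) ℝ := E n 0 + E n 1

/-- The `n × n` matrix `V_n`, where
`V_{n+1} = L_{n,1} E_{n+1,1} + L_{n,2} E_{n+1,2} + E_{n,1} L_{n-1,1} + E_{n,2} L_{n-1,2}`
for `n ≥ 0`; the last two terms vanish for `n = 0`. -/
def V (E : CoeffSeq) : (n : ℕ) → Matrix (Fin n) (Fin n) ℝ
  | 0 => 0
  | n + 1 =>
      L (n + 1) 0 * E (n + 1) 0 + L (n + 1) 1 * E (n + 1) 1 + E n 0 * L n 0 + E n 1 * L n 1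

end Freud

end

/-!
The moments of the Freud weight exist because it is dominated by a Gaussian on `times a40 a04`
(`exists_weight_le`), so integration against it is a linear functional `φ_t` on polynomials
(`momentFunctional`). This functional is positive definite and invariant under
`(x, y) ↦ (-x, -y)`, and nothing else is needed for the algebraic part. With `lowDegree n` the space
of polynomials of degree less than `n`, `Q_{n,k}` is `x^(n-k) y^k` minus its orthogonal projection to
`lowDegree n`, computed with an inverse Gram matrix (`orthPart`). By monicity and central symmetry
`x_i Q_n - L_{n,i} Q_{n+1}` has degree less than `n`, and it is orthogonal to `lowDegree (n - 1)`,
hence a combination of the entries of `Q_{n-1}`; this is the three term relation.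

For the lattice equation let `H_n = (Q_n, Q_nᵀ)` be the Gram matrices. Computing `(x_i Q_{n+1}, Q_nᵀ)`
in two ways gives `E_{n+1,i} H_n = H_{n+1} L_{n,i}ᵀ` (`IsOrth.mul_gram`), and expanding
`(x_i Q_n, x_i Q_nᵀ)` gives `((x² + y²) Q_n, Q_nᵀ) = V_{n+1} H_n` (`IsOrth.gram_sq`). The derivative
of `φ_t(f)` is `φ_t((x² + y²) f)`. The variation of `Q_n` has degree less than `n` and is orthogonal
to `Q_n`, so it does not contribute to the derivative of `H_n` (`hasDerivAt_gram`), and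
`H_n' = V_{n+1} H_n`. Differentiating `E_{n+1,i} H_n = H_{n+1} L_{n,i}ᵀ` and cancelling `H_n` yields
`E_{n+1,i}' = V_{n+2} E_{n+1,i} - E_{n+1,i} V_{n+1}` for each `i` (`hasDerivAt_recurrence`); the
asserted equation is the sum of these two.
-/

noncomputable section

namespace Freud

/-! ### Polynomials of bounded degree -/

/-- The polynomials of total degree less than `n`; for `n = 0` this is the zero subspace. -/
def lowDegree (n : ℕ) : Submodule ℝ Poly2 :=
  MvPolynomial.restrictSupport ℝ {d | d.degree < n}

lemma mem_lowDegree {n : ℕ} {p : Poly2} :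
    p ∈ lowDegree n ↔ ∀ d : Fin 2 →₀ ℕ, n ≤ d.degree → p.coeff d = 0 := by
  rw [lowDegree, MvPolynomial.mem_restrictSupport_iff]
  constructor
  · intro h d hd
    by_contra hne
    have := h (MvPolynomial.mem_support_iff.2 hne)
    simp only [Set.mem_ofPred_eq] at this
    omega
  · intro h d hd
    by_contra hlt
    exact MvPolynomial.mem_support_iff.1 hd (h d (not_lt.1 hlt))

instance (n : ℕ) : Module.Finite ℝ (lowDegree n) :=
  have : Finite {d : Fin 2 →₀ ℕ | d.degree < n} := Finsupp.finite_of_degree_lt n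
  Module.Finite.of_basis (MvPolynomial.basisRestrictSupport ℝ {d : Fin 2 →₀ ℕ | d.degree < n})

lemma lowDegree_mono {m n : ℕ} (h : m ≤ n) : lowDegree m ≤ lowDegree n := fun _ hp =>
  mem_lowDegree.2 fun d hd => mem_lowDegree.1 hp d (h.trans hd)

lemma X_mul_mem_lowDegree {n : ℕ} {p : Poly2} (hp : p ∈ lowDegree n) (i : Fin 2) :
    MvPolynomial.X i * p ∈ lowDegree (n + 1) := by
  refine mem_lowDegree.2 fun d hd => ?_
  rw [MvPolynomial.coeff_X_mul']
  split_ifs with hi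
  · refine mem_lowDegree.1 hp _ ?_
    have h1 : d i ≠ 0 := Finsupp.mem_support_iff.1 hi
    have h2 : d - Finsupp.single i 1 + Finsupp.single i 1 = d :=
      tsub_add_cancel_of_le (Finsupp.single_le_iff.2 (Nat.one_le_iff_ne_zero.2 h1))
    have h3 := congrArg Finsupp.degree h2
    rw [map_add, Finsupp.degree_single] at h3
    omega
  · rfl

/-- The exponent of the monomial `x^(n-k) y^k`. -/
def expo (n k : ℕ) : Fin 2 →₀ ℕ := Finsupp.single 0 (n - k) + Finsupp.single 1 k

lemma expo_zero (n k : ℕ) : expo n k 0 = n - k := by simp [expo]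

lemma expo_one (n k : ℕ) : expo n k 1 = k := by simp [expo]

lemma expo_inj {n k l : ℕ} : expo n k = expo n l ↔ k = l :=
  ⟨fun h => by simpa [expo_one] using DFunLike.congr_fun h 1, fun h => h ▸ rfl⟩

lemma degree_expo {n k : ℕ} (h : k ≤ n) : (expo n k).degree = n := by
  rw [expo, map_add, Finsupp.degree_single, Finsupp.degree_single]
  omega

lemma eq_expo {n : ℕ} {d : Fin 2 →₀ ℕ} (h : d.degree = n) :
    ∃ k : Fin (n + 1), d = expo n k := by
  rw [Finsupp.degree_eq_sum, Fin.sum_univ_two] at h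
  refine ⟨⟨d 1, by omega⟩, Finsupp.ext fun i => ?_⟩
  fin_cases i
  · simp only [Fin.zero_eta, expo_zero]
    omega
  · simp only [Fin.mk_one, expo_one]

lemma X_mul_monomial_expo {n k : ℕ} (h : k ≤ n) (i : Fin 2) :
    (MvPolynomial.X i : Poly2) * MvPolynomial.monomial (expo n k) 1 =
      MvPolynomial.monomial (expo (n + 1) (k + i)) 1 := by
  rw [MvPolynomial.X, MvPolynomial.monomial_mul, one_mul]
  refine congrArg (fun d => MvPolynomial.monomial d (1 : ℝ)) (Finsupp.ext fun j => ?_)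
  fin_cases i <;> fin_cases j <;> simp [expo] <;> omega

/-! ### Monic systems -/

/-- `Q_{n,k}` is `x^(n-k) y^k` plus a polynomial of total degree less than `n`. -/
def IsMonic (Q : VecSeq) : Prop :=
  ∀ (n : ℕ) (k : Fin (n + 1)), Q n k - MvPolynomial.monomial (expo n k) 1 ∈ lowDegree n

lemma IsMonic.coeff_expo {Q : VecSeq} (hQ : IsMonic Q) {n : ℕ} (r k : Fin (n + 1)) :
    (Q n r).coeff (expo n k) = if k = r then 1 else 0 := by
  have h := mem_lowDegree.1 (hQ n r) (expo n k) (degree_expo (by omega)).ge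
  rw [MvPolynomial.coeff_sub, sub_eq_zero, MvPolynomial.coeff_monomial] at h
  simp only [h, expo_inj, Fin.ext_iff, eq_comm]

lemma IsMonic.mem_lowDegree {Q : VecSeq} (hQ : IsMonic Q) (n : ℕ) (r : Fin (n + 1)) :
    Q n r ∈ lowDegree (n + 1) := by
  have h1 : MvPolynomial.monomial (expo n r) (1 : ℝ) ∈ lowDegree (n + 1) := by
    refine Freud.mem_lowDegree.2 fun d hd => ?_
    rw [MvPolynomial.coeff_monomial, if_neg]
    rintro rfl
    rw [degree_expo (by omega)] at hd
    omega
  simpa using add_mem (lowDegree_mono n.le_succ (hQ n r)) h1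

/-- Subtracting a combination of the monic polynomials of degree `n` removes the homogeneous part
of degree `n`. -/
lemma IsMonic.sub_sum_mem {Q : VecSeq} (hQ : IsMonic Q) {n : ℕ} {f : Poly2}
    (hf : f ∈ lowDegree (n + 1)) :
    f - ∑ k : Fin (n + 1), f.coeff (expo n k) • Q n k ∈ lowDegree n := by
  refine Freud.mem_lowDegree.2 fun d hd => ?_
  rcases hd.eq_or_lt with h | h
  · obtain ⟨k, rfl⟩ := eq_expo h.symm
    simp [MvPolynomial.coeff_sum, hQ.coeff_expo]
  · refine Freud.mem_lowDegree.1 (sub_mem hf (sum_mem fun k _ => ?_)) d h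
    exact Submodule.smul_mem _ _ (hQ.mem_lowDegree n k)

lemma IsMonic.linearIndependent {Q : VecSeq} (hQ : IsMonic Q) (n : ℕ) :
    LinearIndependent ℝ (Q n) := by
  rw [Fintype.linearIndependent_iff]
  intro g hg k
  have := congrArg (MvPolynomial.coeff (expo n k)) hg
  simpa [MvPolynomial.coeff_sum, hQ.coeff_expo] using this

lemma IsMonic.ne_zero {Q : VecSeq} (hQ : IsMonic Q) (n : ℕ) (r : Fin (n + 1)) : Q n r ≠ 0 :=
  (hQ.linearIndependent n).ne_zero r

lemma IsMonic.totalDegree_eq {Q : VecSeq} (hQ : IsMonic Q) (n : ℕ) (r : Fin (n + 1)) :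
    (Q n r).totalDegree = n := by
  apply le_antisymm
  · rw [MvPolynomial.totalDegree_eq, Finset.sup_le_iff]
    intro d hd
    by_contra hlt
    rw [MvPolynomial.mem_support_iff] at hd
    refine hd (Freud.mem_lowDegree.1 (hQ.mem_lowDegree n r) d ?_)
    rw [Finsupp.card_toMultiset, Finsupp.sum] at hlt
    rw [Finsupp.degree_apply]
    simp only [id] at hlt
    omega
  · have h : expo n r ∈ (Q n r).support := by
      rw [MvPolynomial.mem_support_iff, hQ.coeff_expo]
      simp
    have h2 := MvPolynomial.le_totalDegree h
    have h3 := degree_expo (n := n) (k := r) (by omega)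
    rw [Finsupp.degree_apply] at h3
    rw [Finsupp.sum] at h2
    omega

lemma isMonic_of_leadingMatrix {Q : VecSeq} (hs : IsPolynomialSystem Q)
    (hm : ∀ n, leadingMatrix Q n = 1) : IsMonic Q := by
  intro n r
  refine mem_lowDegree.2 fun d hd => ?_
  rw [MvPolynomial.coeff_sub]
  rcases hd.eq_or_lt with h | h
  · obtain ⟨k, rfl⟩ := eq_expo h.symm
    have h1 : (Q n r).coeff (expo n k) = (1 : Matrix (Fin (n + 1)) (Fin (n + 1)) ℝ) r k := by
      rw [← hm n]
      rfl
    rw [h1, MvPolynomial.coeff_monomial, Matrix.one_apply, sub_eq_zero]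
    simp only [expo_inj, Fin.ext_iff]
  · rw [MvPolynomial.coeff_eq_zero_of_totalDegree_lt, MvPolynomial.coeff_monomial, if_neg, sub_zero]
    · rintro rfl
      rw [degree_expo (by omega)] at h
      omega
    · rw [((hs n).1 r).2]
      exact h

lemma IsMonic.leadingMatrix_eq {Q : VecSeq} (hQ : IsMonic Q) (n : ℕ) : leadingMatrix Q n = 1 := by
  ext r k
  have := hQ.coeff_expo r k
  rw [leadingMatrix, Matrix.of_apply, Matrix.one_apply]
  rw [expo] at this
  rw [this]
  simp only [eq_comm]

/-! ### Positive functionals and Gram matrices -/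

/-- The functional `φ` on polynomials is positive definite: `φ (f²) > 0` for `f ≠ 0`. -/
def IsPositive (φ : Poly2 →ₗ[ℝ] ℝ) : Prop := ∀ f : Poly2, f ≠ 0 → 0 < φ (f * f)

lemma IsPositive.eq_zero {φ : Poly2 →ₗ[ℝ] ℝ} (hφ : IsPositive φ) {f : Poly2}
    (h : φ (f * f) = 0) : f = 0 := by
  by_contra hf
  exact (hφ f hf).ne' h

/-- The Gram matrix of the polynomials `p i` with respect to the form `(f, g) ↦ φ (f g)`. -/
def gram (φ : Poly2 →ₗ[ℝ] ℝ) {ι : Type*} (p : ι → Poly2) : Matrix ι ι ℝ :=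
  Matrix.of fun i j => φ (p i * p j)

lemma IsPositive.isUnit_det_gram {φ : Poly2 →ₗ[ℝ] ℝ} (hφ : IsPositive φ) {ι : Type*} [Fintype ι]
    [DecidableEq ι] {p : ι → Poly2} (hp : LinearIndependent ℝ p) : IsUnit (gram φ p).det := by
  rw [isUnit_iff_ne_zero]
  intro h0
  obtain ⟨v, hv, hv0⟩ := Matrix.exists_mulVec_eq_zero_iff.2 h0
  refine hv (funext (Fintype.linearIndependent_iff.1 hp v (hφ.eq_zero ?_)))
  have h : ∀ i, φ (p i * ∑ j, v j • p j) = 0 := fun i => by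
    have := congrFun hv0 i
    simp only [Matrix.mulVec, dotProduct, gram, Matrix.of_apply, Pi.zero_apply] at this
    simp only [Finset.mul_sum, map_sum, mul_smul_comm, map_smul, smul_eq_mul]
    rw [← this]
    exact Finset.sum_congr rfl fun j _ => mul_comm _ _
  rw [Finset.sum_mul, map_sum]
  refine Finset.sum_eq_zero fun i _ => ?_
  rw [smul_mul_assoc, map_smul, h, smul_zero]

/-- The basis of `lowDegree n` in whose coordinates projections are computed. -/
def lowBasis (n : ℕ) (j : Fin (Module.finrank ℝ (lowDegree n))) : Poly2 :=
  Module.finBasis ℝ (lowDegree n) j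

lemma lowBasis_mem (n : ℕ) (j : Fin (Module.finrank ℝ (lowDegree n))) :
    lowBasis n j ∈ lowDegree n := Subtype.property _

lemma linearIndependent_lowBasis (n : ℕ) : LinearIndependent ℝ (lowBasis n) :=
  (Module.finBasis ℝ (lowDegree n)).linearIndependent.map' (lowDegree n).subtype
    (Submodule.ker_subtype _)

lemma exists_eq_sum_lowBasis {n : ℕ} {p : Poly2} (hp : p ∈ lowDegree n) :
    ∃ c : Fin (Module.finrank ℝ (lowDegree n)) → ℝ, p = ∑ j, c j • lowBasis n j := by
  refine ⟨(Module.finBasis ℝ (lowDegree n)).repr ⟨p, hp⟩, ?_⟩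
  have := congrArg (lowDegree n).subtype ((Module.finBasis ℝ (lowDegree n)).sum_repr ⟨p, hp⟩)
  rw [map_sum] at this
  exact this.symm

/-- The coordinates, in `lowBasis n`, of the projection of `f` to `lowDegree n`. -/
def projCoeff (φ : Poly2 →ₗ[ℝ] ℝ) (n : ℕ) (f : Poly2) :
    Fin (Module.finrank ℝ (lowDegree n)) → ℝ :=
  Matrix.vecMul (fun j => φ (f * lowBasis n j)) (gram φ (lowBasis n))⁻¹

/-- The difference between `f` and its orthogonal projection to `lowDegree n`. -/
def orthPart (φ : Poly2 →ₗ[ℝ] ℝ) (n : ℕ) (f : Poly2) : Poly2 :=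
  f - ∑ j, projCoeff φ n f j • lowBasis n j

lemma sub_orthPart_mem (φ : Poly2 →ₗ[ℝ] ℝ) (n : ℕ) (f : Poly2) :
    f - orthPart φ n f ∈ lowDegree n := by
  rw [orthPart, sub_sub_cancel]
  exact sum_mem fun j _ => Submodule.smul_mem _ _ (lowBasis_mem n j)

lemma IsPositive.orthPart_orthogonal {φ : Poly2 →ₗ[ℝ] ℝ} (hφ : IsPositive φ) (n : ℕ) (f : Poly2)
    {p : Poly2} (hp : p ∈ lowDegree n) : φ (orthPart φ n f * p) = 0 := by
  obtain ⟨c, rfl⟩ := exists_eq_sum_lowBasis hp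
  rw [Finset.mul_sum, map_sum]
  refine Finset.sum_eq_zero fun k _ => ?_
  rw [mul_smul_comm, map_smul, smul_eq_mul]
  refine mul_eq_zero_of_right _ ?_
  have h : Matrix.vecMul (projCoeff φ n f) (gram φ (lowBasis n)) k = φ (f * lowBasis n k) := by
    rw [projCoeff, Matrix.vecMul_vecMul, Matrix.nonsing_inv_mul _
      (hφ.isUnit_det_gram (linearIndependent_lowBasis n)), Matrix.vecMul_one]
  rw [orthPart, sub_mul, map_sub, ← h, Finset.sum_mul, map_sum, sub_eq_zero]
  simp [Matrix.vecMul, dotProduct, gram]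

/-! ### Monic orthogonal systems -/

/-- `Q` is monic and every `Q_{n,k}` is orthogonal to all polynomials of total degree less than
`n`, for the form `(f, g) ↦ φ (f g)`. -/
structure IsOrth (φ : Poly2 →ₗ[ℝ] ℝ) (Q : VecSeq) : Prop where
  monic : IsMonic Q
  orth : ∀ (n : ℕ) (r : Fin (n + 1)), ∀ p ∈ lowDegree n, φ (Q n r * p) = 0

/-- A polynomial orthogonal to `lowDegree n` is determined modulo `lowDegree n`. -/
lemma IsPositive.eq_of_sub_mem {φ : Poly2 →ₗ[ℝ] ℝ} (hφ : IsPositive φ) {n : ℕ} {f g : Poly2}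
    (hf : ∀ p ∈ lowDegree n, φ (f * p) = 0) (hg : ∀ p ∈ lowDegree n, φ (g * p) = 0)
    (h : f - g ∈ lowDegree n) : f = g := by
  rw [← sub_eq_zero]
  refine hφ.eq_zero ?_
  rw [sub_mul, map_sub, hf _ h, hg _ h, sub_zero]

lemma IsOrth.unique {φ : Poly2 →ₗ[ℝ] ℝ} (hφ : IsPositive φ) {P Q : VecSeq} (hP : IsOrth φ P)
    (hQ : IsOrth φ Q) : P = Q := by
  funext n r
  refine hφ.eq_of_sub_mem (hP.orth n r) (hQ.orth n r) ?_
  simpa using sub_mem (hP.monic n r) (hQ.monic n r)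

lemma IsPositive.isOrth_orthPart {φ : Poly2 →ₗ[ℝ] ℝ} (hφ : IsPositive φ) :
    IsOrth φ fun n k => orthPart φ n (MvPolynomial.monomial (expo n k) 1) where
  monic n k := by
    rw [← neg_mem_iff, neg_sub]
    exact sub_orthPart_mem φ n _
  orth n k _ hp := hφ.orthPart_orthogonal n _ hp

/-- Orthogonality to the earlier members of a monic system is orthogonality to all polynomials of
lower degree. -/
lemma IsMonic.orthogonal_lowDegree {φ : Poly2 →ₗ[ℝ] ℝ} {Q : VecSeq} (hQ : IsMonic Q) {f : Poly2}
    {n : ℕ} (h : ∀ m < n, ∀ k, φ (f * Q m k) = 0) {p : Poly2} (hp : p ∈ lowDegree n) :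
    φ (f * p) = 0 := by
  induction n generalizing p with
  | zero =>
    have : p = 0 := MvPolynomial.ext _ _ fun d => by
      simpa using Freud.mem_lowDegree.1 hp d (Nat.zero_le _)
    rw [this, mul_zero, map_zero]
  | succ n ih =>
    have h1 := ih (fun m hm => h m (hm.trans n.lt_succ_self)) (hQ.sub_sum_mem hp)
    rw [mul_sub, map_sub, sub_eq_zero] at h1
    rw [h1, Finset.mul_sum, map_sum]
    refine Finset.sum_eq_zero fun k _ => ?_
    rw [mul_smul_comm, map_smul, h n n.lt_succ_self, smul_zero]

/-- A polynomial of degree at most `n` that is orthogonal to all lower degrees is a combination of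
the `Q_{n,k}`. -/
lemma IsOrth.eq_sum {φ : Poly2 →ₗ[ℝ] ℝ} (hφ : IsPositive φ) {Q : VecSeq} (hQ : IsOrth φ Q) {n : ℕ}
    {f : Poly2} (hf : f ∈ lowDegree (n + 1)) (h : ∀ p ∈ lowDegree n, φ (f * p) = 0) :
    f = ∑ k : Fin (n + 1), f.coeff (expo n k) • Q n k := by
  refine hφ.eq_of_sub_mem h (fun p hp => ?_) (hQ.monic.sub_sum_mem hf)
  rw [Finset.sum_mul, map_sum]
  refine Finset.sum_eq_zero fun k _ => ?_
  rw [smul_mul_assoc, map_smul, hQ.orth n k p hp, smul_zero]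

/-! ### Central symmetry -/

/-- The substitution `(x, y) ↦ (-x, -y)`. -/
def reflect : Poly2 →ₐ[ℝ] Poly2 := MvPolynomial.aeval fun i => -MvPolynomial.X i

lemma coeff_reflect (f : Poly2) (d : Fin 2 →₀ ℕ) :
    (reflect f).coeff d = (-1) ^ d.degree * f.coeff d := by
  induction f using MvPolynomial.induction_on' with
  | monomial u a =>
    have : reflect (MvPolynomial.monomial u a) =
        MvPolynomial.monomial u ((-1) ^ u.degree * a) := by
      rw [reflect, MvPolynomial.aeval_monomial, MvPolynomial.monomial_eq,
        Finsupp.prod_fintype _ _ (by simp), Finsupp.prod_fintype _ _ (by simp),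
        Finsupp.degree_eq_sum, Fin.prod_univ_two, Fin.prod_univ_two, Fin.sum_univ_two,
        MvPolynomial.algebraMap_eq, neg_pow (MvPolynomial.X 0 : Poly2),
        neg_pow (MvPolynomial.X 1 : Poly2), pow_add]
      simp only [MvPolynomial.C_mul, MvPolynomial.C_pow, MvPolynomial.C_neg, MvPolynomial.C_1]
      ring
    rw [this, MvPolynomial.coeff_monomial, MvPolynomial.coeff_monomial]
    split_ifs with h
    · rw [h]
    · rw [mul_zero]
  | add p q hp hq => rw [map_add, MvPolynomial.coeff_add, hp, hq, MvPolynomial.coeff_add, mul_add]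

lemma reflect_reflect (f : Poly2) : reflect (reflect f) = f := by
  ext d
  rw [coeff_reflect, coeff_reflect, ← mul_assoc, ← mul_pow]
  simp

lemma reflect_mem_lowDegree {n : ℕ} {f : Poly2} (hf : f ∈ lowDegree n) :
    reflect f ∈ lowDegree n :=
  mem_lowDegree.2 fun d hd => by rw [coeff_reflect, mem_lowDegree.1 hf d hd, mul_zero]

/-- For a centrally symmetric functional, `Q_n(-x, -y) = (-1)^n Q_n(x, y)`: both sides, up to the
sign, are monic and orthogonal to all lower degrees. -/
lemma IsOrth.reflect_eq {φ : Poly2 →ₗ[ℝ] ℝ} (hφ : IsPositive φ)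
    (hsymm : ∀ f, φ (reflect f) = φ f) {Q : VecSeq} (hQ : IsOrth φ Q) (n : ℕ) (r : Fin (n + 1)) :
    reflect (Q n r) = (-1 : ℝ) ^ n • Q n r := by
  refine hφ.eq_of_sub_mem (n := n) (fun p hp => ?_) (fun p hp => ?_)
    (mem_lowDegree.2 fun d hd => ?_)
  · rw [← hsymm, map_mul, reflect_reflect, hQ.orth n r _ (reflect_mem_lowDegree hp)]
  · rw [smul_mul_assoc, map_smul, hQ.orth n r p hp, smul_zero]
  · rw [MvPolynomial.coeff_sub, coeff_reflect, MvPolynomial.coeff_smul, smul_eq_mul]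
    rcases hd.eq_or_lt with h | h
    · rw [← h, sub_self]
    · rw [mem_lowDegree.1 (hQ.monic.mem_lowDegree n r) d h, mul_zero, mul_zero, sub_zero]

lemma IsOrth.coeff_eq_zero {φ : Poly2 →ₗ[ℝ] ℝ} (hφ : IsPositive φ)
    (hsymm : ∀ f, φ (reflect f) = φ f) {Q : VecSeq} (hQ : IsOrth φ Q) {n : ℕ} {r : Fin (n + 1)}
    {d : Fin 2 →₀ ℕ} (hd : Odd (n + d.degree)) : (Q n r).coeff d = 0 := by
  have h := congrArg (MvPolynomial.coeff d) (hQ.reflect_eq hφ hsymm n r)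
  rw [coeff_reflect, MvPolynomial.coeff_smul, smul_eq_mul] at h
  have h2 : ((-1 : ℝ) ^ n * (-1) ^ d.degree) = -1 := by rw [← pow_add, hd.neg_one_pow]
  have h3 : ((-1 : ℝ) ^ n * (-1) ^ n) = 1 := by rw [← mul_pow]; simp
  have h4 : ((-1 : ℝ) ^ n * (-1) ^ d.degree) * (Q n r).coeff d =
      ((-1 : ℝ) ^ n * (-1) ^ n) * (Q n r).coeff d := by rw [mul_assoc, h, mul_assoc]
  rw [h2, h3] at h4
  linarith

/-! ### The three term relations -/

/-- The three term relations, entry by entry. -/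
lemma isThreeTerm_iff {Q : VecSeq} {E : CoeffSeq} :
    IsThreeTerm Q E ↔ ∀ (n : ℕ) (i : Fin 2) (r : Fin (n + 1)),
      MvPolynomial.X i * Q n r =
        ∑ k, L (n + 1) i r k • Q (n + 1) k + ∑ k, E n i r k • prev Q n k := by
  simp only [IsThreeTerm, funext_iff, Pi.add_apply, Matrix.mulVec, dotProduct, Matrix.map_apply,
    MvPolynomial.C_mul']

lemma sum_L_smul {M : Type*} [AddCommMonoid M] [Module ℝ M] {n : ℕ} (i : Fin 2) (r : Fin n)
    (v : Fin (n + 1) → M) :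
    ∑ k, L n i r k • v k = v ⟨r + i, by omega⟩ := by
  rw [Finset.sum_eq_single ⟨r + i, by omega⟩]
  · simp [L]
  · intro k _ hk
    rw [L, Matrix.of_apply, if_neg, zero_smul]
    exact fun h => hk (Fin.ext h)
  · simp

/-- The defect `x_i Q_n - L_{n,i} Q_{n+1}` has degree less than `n`: the terms of degree `n + 1`
cancel, and those of degree `n` vanish by central symmetry. -/
lemma IsOrth.defect_mem {φ : Poly2 →ₗ[ℝ] ℝ} (hφ : IsPositive φ)
    (hsymm : ∀ f, φ (reflect f) = φ f) {Q : VecSeq} (hQ : IsOrth φ Q) (n : ℕ) (i : Fin 2)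
    (r : Fin (n + 1)) :
    MvPolynomial.X i * Q n r - Q (n + 1) ⟨r + i, by omega⟩ ∈ lowDegree n := by
  have h1 : MvPolynomial.X i * Q n r - Q (n + 1) ⟨r + i, by omega⟩ ∈ lowDegree (n + 1) := by
    have h2 := X_mul_mem_lowDegree (hQ.monic n r) i
    rw [mul_sub, X_mul_monomial_expo (by omega)] at h2
    simpa using sub_mem h2 (hQ.monic (n + 1) ⟨r + i, by omega⟩)
  refine mem_lowDegree.2 fun d hd => ?_
  rcases hd.eq_or_lt with h | h
  · rw [MvPolynomial.coeff_sub, MvPolynomial.coeff_X_mul',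
      hQ.coeff_eq_zero hφ hsymm (n := n + 1) ⟨n, by omega⟩, sub_zero]
    split_ifs with hi
    · have h2 : d - Finsupp.single i 1 + Finsupp.single i 1 = d :=
        tsub_add_cancel_of_le (Finsupp.single_le_iff.2
          (Nat.one_le_iff_ne_zero.2 (Finsupp.mem_support_iff.1 hi)))
      have h3 := congrArg Finsupp.degree h2
      rw [map_add, Finsupp.degree_single] at h3
      exact hQ.coeff_eq_zero hφ hsymm ⟨(d - Finsupp.single i 1).degree, by omega⟩
    · rfl
  · exact mem_lowDegree.1 h1 d h

theorem IsOrth.exists_isThreeTerm {φ : Poly2 →ₗ[ℝ] ℝ} (hφ : IsPositive φ)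
    (hsymm : ∀ f, φ (reflect f) = φ f) {Q : VecSeq} (hQ : IsOrth φ Q) :
    ∃ E : CoeffSeq, IsThreeTerm Q E := by
  refine ⟨fun n i => Matrix.of fun r k => MvPolynomial.coeff (expo (n - 1) k)
    (MvPolynomial.X i * Q n r - Q (n + 1) ⟨r + i, by omega⟩), isThreeTerm_iff.2 fun n i r => ?_⟩
  rw [sum_L_smul (i := i) (r := r), ← sub_eq_iff_eq_add']
  have hmem := hQ.defect_mem hφ hsymm n i r
  cases n with
  | zero =>
    rw [Finset.univ_eq_empty, Finset.sum_empty]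
    exact MvPolynomial.ext _ _ fun d => by
      simpa using mem_lowDegree.1 hmem d (Nat.zero_le _)
  | succ n =>
    refine hQ.eq_sum hφ hmem fun p hp => ?_
    rw [sub_mul, map_sub, mul_comm (MvPolynomial.X i), mul_assoc,
      hQ.orth _ _ _ (X_mul_mem_lowDegree hp i),
      hQ.orth _ _ _ (lowDegree_mono (by omega) hp), sub_zero]

lemma IsMonic.isThreeTerm_unique {Q : VecSeq} (hQ : IsMonic Q) {E E' : CoeffSeq}
    (hE : IsThreeTerm Q E) (hE' : IsThreeTerm Q E') : E = E' := by
  funext n i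
  ext r c
  have h := (isThreeTerm_iff.1 hE n i r).symm.trans (isThreeTerm_iff.1 hE' n i r)
  rw [add_right_inj, ← sub_eq_zero, ← Finset.sum_sub_distrib] at h
  simp only [← sub_smul] at h
  cases n with
  | zero => exact c.elim0
  | succ n => exact sub_eq_zero.1 (Fintype.linearIndependent_iff.1 (hQ.linearIndependent n) _ h c)

/-! ### Recurrence coefficients and Gram matrices -/

lemma IsOrth.orthogonal {φ : Poly2 →ₗ[ℝ] ℝ} {Q : VecSeq} (hQ : IsOrth φ Q) {n m : ℕ}
    (hnm : n ≠ m) (r : Fin (n + 1)) (k : Fin (m + 1)) : φ (Q n r * Q m k) = 0 := by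
  rcases hnm.lt_or_gt with h | h
  · rw [mul_comm]
    exact hQ.orth m k _ (lowDegree_mono h (hQ.monic.mem_lowDegree n r))
  · exact hQ.orth n r _ (lowDegree_mono h (hQ.monic.mem_lowDegree m k))

lemma IsOrth.isUnit_det_gram {φ : Poly2 →ₗ[ℝ] ℝ} (hφ : IsPositive φ) {Q : VecSeq}
    (hQ : IsOrth φ Q) (n : ℕ) : IsUnit (gram φ (Q n)).det :=
  hφ.isUnit_det_gram (hQ.monic.linearIndependent n)

lemma IsOrth.apply_X_mul {φ : Poly2 →ₗ[ℝ] ℝ} {Q : VecSeq} (hQ : IsOrth φ Q) {E : CoeffSeq}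
    (hE : IsThreeTerm Q E) (n : ℕ) (i : Fin 2) (r : Fin (n + 2)) (c : Fin (n + 1)) :
    φ (MvPolynomial.X i * Q (n + 1) r * Q n c) = (E (n + 1) i * gram φ (Q n)) r c := by
  rw [isThreeTerm_iff.1 hE, add_mul, map_add, Finset.sum_mul, map_sum, Finset.sum_eq_zero, zero_add]
  · simp [Finset.sum_mul, prev, Matrix.mul_apply, gram]
  · intro k _
    rw [smul_mul_assoc, map_smul, hQ.orthogonal (by omega), smul_zero]

lemma IsOrth.apply_mul_X_mul {φ : Poly2 →ₗ[ℝ] ℝ} {Q : VecSeq} (hQ : IsOrth φ Q) {E : CoeffSeq}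
    (hE : IsThreeTerm Q E) (n : ℕ) (i : Fin 2) (r : Fin (n + 2)) (c : Fin (n + 1)) :
    φ (Q (n + 1) r * (MvPolynomial.X i * Q n c)) =
      (gram φ (Q (n + 1)) * (L (n + 1) i).transpose) r c := by
  rw [isThreeTerm_iff.1 hE, mul_add, map_add, Finset.mul_sum, Finset.mul_sum, map_sum, map_sum,
    Finset.sum_eq_zero (s := Finset.univ) (f := fun x => φ (Q (n + 1) r * E n i c x • prev Q n x)),
    add_zero]
  · simp [Matrix.mul_apply, gram, mul_comm]
  · intro k _
    cases n with
    | zero => exact k.elim0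
    | succ n =>
      rw [mul_smul_comm, map_smul]
      simp only [prev]
      rw [hQ.orthogonal (by omega), smul_zero]

/-- `E_{n+1,i} H_n = H_{n+1} L_{n,i}ᵀ` for the Gram matrices `H_n = (Q_n, Q_nᵀ)`: both sides are
`(x_i Q_{n+1}, Q_nᵀ)`. -/
lemma IsOrth.mul_gram {φ : Poly2 →ₗ[ℝ] ℝ} {Q : VecSeq} (hQ : IsOrth φ Q) {E : CoeffSeq}
    (hE : IsThreeTerm Q E) (n : ℕ) (i : Fin 2) :
    E (n + 1) i * gram φ (Q n) = gram φ (Q (n + 1)) * (L (n + 1) i).transpose := by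
  ext r c
  rw [← hQ.apply_X_mul hE, ← hQ.apply_mul_X_mul hE, mul_comm (MvPolynomial.X i), mul_assoc]

/-- `((x² + y²) Q_n, Q_nᵀ) = V_{n+1} H_n`. -/
lemma IsOrth.gram_sq {φ : Poly2 →ₗ[ℝ] ℝ} {Q : VecSeq} (hQ : IsOrth φ Q) {E : CoeffSeq}
    (hE : IsThreeTerm Q E) (n : ℕ) (r c : Fin (n + 1)) :
    φ ((MvPolynomial.X 0 ^ 2 + MvPolynomial.X 1 ^ 2) * (Q n r * Q n c)) =
      (V E (n + 1) * gram φ (Q n)) r c := by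
  have key : ∀ i : Fin 2, φ (MvPolynomial.X i ^ 2 * (Q n r * Q n c)) =
      ((L (n + 1) i * E (n + 1) i + E n i * L n i) * gram φ (Q n)) r c := by
    intro i
    have h1 : (MvPolynomial.X i ^ 2 * (Q n r * Q n c) : Poly2) =
      MvPolynomial.X i * Q n r * (MvPolynomial.X i * Q n c) := by ring
    rw [h1, isThreeTerm_iff.1 hE n i r, add_mul, map_add, Matrix.add_mul, Matrix.mul_assoc,
      Matrix.mul_assoc, Matrix.add_apply, Matrix.mul_apply, Matrix.mul_apply, Finset.sum_mul,
      Finset.sum_mul, map_sum, map_sum]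
    congr 1
    · refine Finset.sum_congr rfl fun k _ => ?_
      rw [smul_mul_assoc, map_smul, smul_eq_mul, ← hQ.apply_X_mul hE]
      congr 2
      ring
    · refine Finset.sum_congr rfl fun k _ => ?_
      cases n with
      | zero => exact k.elim0
      | succ n =>
        rw [smul_mul_assoc, map_smul, smul_eq_mul]
        congr 1
        have h2 : (prev Q (n + 1) k * (MvPolynomial.X i * Q (n + 1) c) : Poly2) =
          Q (n + 1) c * (MvPolynomial.X i * Q n k) := by
          simp only [prev]
          ring
        rw [h2, hQ.apply_mul_X_mul hE]
        simp [Matrix.mul_apply, gram, mul_comm]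
  have hV : V E (n + 1) =
      (L (n + 1) 0 * E (n + 1) 0 + E n 0 * L n 0) +
        (L (n + 1) 1 * E (n + 1) 1 + E n 1 * L n 1) := by
    simp only [V]
    abel
  rw [add_mul, map_add, key, key, hV, Matrix.add_mul (_ + _), Matrix.add_apply]

open Filter Topology

/-! ### Differentiation of matrices entry by entry -/

lemma hasDerivAt_matrix_mul_apply {l m n : Type*} [Fintype m] {A : ℝ → Matrix l m ℝ}
    {B : ℝ → Matrix m n ℝ} {A' : Matrix l m ℝ} {B' : Matrix m n ℝ} {t : ℝ}
    (hA : ∀ i j, HasDerivAt (fun s => A s i j) (A' i j) t)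
    (hB : ∀ i j, HasDerivAt (fun s => B s i j) (B' i j) t) (i : l) (j : n) :
    HasDerivAt (fun s => (A s * B s) i j) ((A' * B t + A t * B') i j) t := by
  simp only [Matrix.mul_apply, Matrix.add_apply, ← Finset.sum_add_distrib]
  exact HasDerivAt.fun_sum fun k _ => (hA i k).mul (hB k j)

lemma differentiableAt_det {n : Type*} [Fintype n] [DecidableEq n] {A : ℝ → Matrix n n ℝ} {t : ℝ}
    (hA : ∀ i j, DifferentiableAt ℝ (fun s => A s i j) t) :
    DifferentiableAt ℝ (fun s => (A s).det) t := by
  simp only [Matrix.det_apply']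
  exact DifferentiableAt.fun_sum fun σ _ => (DifferentiableAt.fun_finsetProd fun i _ =>
    hA (σ i) i).const_mul _

lemma differentiableAt_matrix_inv_apply {n : Type*} [Fintype n] [DecidableEq n]
    {A : ℝ → Matrix n n ℝ} {t : ℝ} (hA : ∀ i j, DifferentiableAt ℝ (fun s => A s i j) t)
    (hu : IsUnit (A t).det) (i j : n) : DifferentiableAt ℝ (fun s => (A s)⁻¹ i j) t := by
  simp only [Matrix.inv_def, Ring.inverse_eq_inv', Matrix.smul_apply, smul_eq_mul,
    Matrix.adjugate_apply]
  refine ((differentiableAt_det hA).inv hu.ne_zero).mul (differentiableAt_det fun k l => ?_)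
  by_cases h : k = j
  · subst h
    simp
  · simpa [Matrix.updateRow_ne h] using hA k l

/-! ### The lattice equation for a differentiable family of functionals -/

section Family

variable {φ : ℝ → Poly2 →ₗ[ℝ] ℝ} {φ' : Poly2 → ℝ} {t : ℝ}

lemma hasDerivAt_projCoeff_mul (hφ : ∀ f, HasDerivAt (fun s => φ s f) (φ' f) t)
    (hpos : IsPositive (φ t)) {n : ℕ} {f g : Poly2} (hf : ∀ p ∈ lowDegree n, φ t (f * p) = 0)
    (hg : ∀ p ∈ lowDegree n, φ t (g * p) = 0) (j : Fin (Module.finrank ℝ (lowDegree n))) :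
    HasDerivAt (fun s => projCoeff (φ s) n f j * φ s (g * lowBasis n j)) 0 t := by
  have hd : DifferentiableAt ℝ (fun s => projCoeff (φ s) n f j) t := by
    simp only [projCoeff, Matrix.vecMul, dotProduct]
    refine DifferentiableAt.fun_sum fun i _ => (hφ _).differentiableAt.mul ?_
    refine differentiableAt_matrix_inv_apply (fun k l => ?_)
      (hpos.isUnit_det_gram (linearIndependent_lowBasis n)) i j
    exact (hφ _).differentiableAt
  have h0 : projCoeff (φ t) n f j = 0 := by
    simp only [projCoeff, Matrix.vecMul, dotProduct]
    exact Finset.sum_eq_zero fun i _ => by rw [hf _ (lowBasis_mem n i), zero_mul]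
  have := hd.hasDerivAt.mul (hφ (g * lowBasis n j))
  rwa [h0, hg _ (lowBasis_mem n j), mul_zero, zero_mul, add_zero] at this

/-- The derivative of a Gram matrix `(Q_n, Q_nᵀ)` does not see the variation of `Q_n`, which has
lower degree and is therefore orthogonal to `Q_n`. -/
lemma hasDerivAt_gram (hφ : ∀ f, HasDerivAt (fun s => φ s f) (φ' f) t) {Q : ℝ → VecSeq}
    (hpos : ∀ᶠ s in 𝓝 t, IsPositive (φ s)) (hQ : ∀ᶠ s in 𝓝 t, IsOrth (φ s) (Q s))
    (n : ℕ) (r c : Fin (n + 1)) :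
    HasDerivAt (fun s => gram (φ s) (Q s n) r c) (φ' (Q t n r * Q t n c)) t := by
  have hQt := hQ.self_of_nhds
  have h1 := (hφ (Q t n r * Q t n c)).sub (HasDerivAt.fun_sum (u := Finset.univ) fun j _ =>
    hasDerivAt_projCoeff_mul hφ hpos.self_of_nhds (hQt.orth n r) (hQt.orth n c) j)
  rw [Finset.sum_const_zero, sub_zero] at h1
  refine h1.congr_of_eventuallyEq ?_
  filter_upwards [hpos, hQ] with s hps hQs
  have hsub : ∀ k, Q t n k - Q s n k ∈ lowDegree n := fun k => by
    simpa using sub_mem (hQt.monic n k) (hQs.monic n k)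
  have h2 : Q s n r = orthPart (φ s) n (Q t n r) := by
    refine hps.eq_of_sub_mem (hQs.orth n r) (fun p hp => hps.orthPart_orthogonal n _ hp) ?_
    simpa using sub_mem (sub_orthPart_mem (φ s) n (Q t n r)) (hsub r)
  have h3 : φ s (Q s n r * Q s n c) = φ s (Q s n r * Q t n c) := by
    rw [← sub_eq_zero, ← map_sub, ← mul_sub, ← neg_sub (Q t n c), mul_neg, map_neg,
      hQs.orth n r _ (hsub c), neg_zero]
  rw [gram, Matrix.of_apply, h3, h2, orthPart, sub_mul, map_sub, Finset.sum_mul, map_sum]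
  simp only [smul_mul_assoc, map_smul, smul_eq_mul, Pi.sub_apply]
  simp only [mul_comm (lowBasis n _)]

/-- If `φ` evolves by multiplication with `x² + y²`, then each recurrence matrix solves
`E' = V_{n+1} E - E V_n`. -/
lemma hasDerivAt_recurrence
    (hφ : ∀ f, HasDerivAt (fun s => φ s f)
      (φ t ((MvPolynomial.X 0 ^ 2 + MvPolynomial.X 1 ^ 2) * f)) t)
    {Q : ℝ → VecSeq} {E : ℝ → CoeffSeq}
    (hpos : ∀ᶠ s in 𝓝 t, IsPositive (φ s)) (hQ : ∀ᶠ s in 𝓝 t, IsOrth (φ s) (Q s))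
    (hE : ∀ᶠ s in 𝓝 t, IsThreeTerm (Q s) (E s)) (n : ℕ) (i : Fin 2)
    (r : Fin (n + 2)) (c : Fin (n + 1)) :
    HasDerivAt (fun s => E s (n + 1) i r c)
      ((V (E t) (n + 2) * E t (n + 1) i - E t (n + 1) i * V (E t) (n + 1)) r c) t := by
  have hEt := hE.self_of_nhds
  have hQt := hQ.self_of_nhds
  have hH : ∀ m, ∀ a b : Fin (m + 1), HasDerivAt (fun s => gram (φ s) (Q s m) a b)
      ((V (E t) (m + 1) * gram (φ t) (Q t m)) a b) t := fun m a b => by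
    rw [← hQt.gram_sq hEt]
    exact hasDerivAt_gram hφ hpos hQ m a b
  have hu := hQt.isUnit_det_gram hpos.self_of_nhds n
  -- `H_{n+1} Lᵀ` and its derivative
  have hHL : ∀ a b, HasDerivAt (fun s => (gram (φ s) (Q s (n + 1)) * (L (n + 1) i).transpose) a b)
      ((V (E t) (n + 2) * gram (φ t) (Q t (n + 1)) * (L (n + 1) i).transpose) a b) t :=
    fun a b => by
      simpa using hasDerivAt_matrix_mul_apply (B' := 0) (hH (n + 1))
        (fun k l => hasDerivAt_const t ((L (n + 1) i).transpose k l)) a b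
  -- the entries of `E = H_{n+1} Lᵀ H_n⁻¹` are differentiable
  have hd : ∀ a b, DifferentiableAt ℝ (fun s => E s (n + 1) i a b) t := by
    intro a b
    have h1 : DifferentiableAt ℝ (fun s =>
        (gram (φ s) (Q s (n + 1)) * (L (n + 1) i).transpose * (gram (φ s) (Q s n))⁻¹) a b) t :=
      (hasDerivAt_matrix_mul_apply
        (B' := Matrix.of fun k l => deriv (fun s => (gram (φ s) (Q s n))⁻¹ k l) t) hHL
        (fun k l => (differentiableAt_matrix_inv_apply
          (fun k l => (hH n k l).differentiableAt) hu k l).hasDerivAt) a b).differentiableAt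
    refine h1.congr_of_eventuallyEq ?_
    filter_upwards [hpos, hQ, hE] with s hps hQs hEs
    rw [← hQs.mul_gram hEs, Matrix.mul_assoc, Matrix.mul_nonsing_inv _ (hQs.isUnit_det_gram hps n),
      Matrix.mul_one]
  -- the derivative follows from differentiating `E H_n = H_{n+1} Lᵀ`
  obtain ⟨E', hE'⟩ : ∃ E' : Matrix (Fin (n + 2)) (Fin (n + 1)) ℝ,
      ∀ a b, HasDerivAt (fun s => E s (n + 1) i a b) (E' a b) t :=
    ⟨Matrix.of fun a b => deriv (fun s => E s (n + 1) i a b) t, fun a b => (hd a b).hasDerivAt⟩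
  have hEH : E' * gram (φ t) (Q t n) + E t (n + 1) i * (V (E t) (n + 1) * gram (φ t) (Q t n)) =
      V (E t) (n + 2) * (E t (n + 1) i * gram (φ t) (Q t n)) := by
    rw [hQt.mul_gram hEt, ← Matrix.mul_assoc (V (E t) (n + 2))]
    ext a b
    refine (hasDerivAt_matrix_mul_apply hE' (hH n) a b).unique
      ((hHL a b).congr_of_eventuallyEq ?_)
    filter_upwards [hQ, hE] with s hQs hEs
    rw [hQs.mul_gram hEs]
  have hfin : E' = V (E t) (n + 2) * E t (n + 1) i - E t (n + 1) i * V (E t) (n + 1) := by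
    rw [← Matrix.mul_nonsing_inv_cancel_right _ E' hu, eq_sub_of_add_eq hEH, ← Matrix.mul_assoc,
      ← Matrix.mul_assoc, ← Matrix.sub_mul, Matrix.mul_nonsing_inv_cancel_right _ _ hu]
  exact hfin ▸ hE' r c

end Family

/-! ### The Freud weight -/

lemma weight_pos (a40 a22 a04 t : ℝ) (z : ℝ × ℝ) : 0 < weight a40 a22 a04 t z := Real.exp_pos _

lemma continuous_weight (a40 a22 a04 t : ℝ) : Continuous (weight a40 a22 a04 t) := by
  unfold weight
  fun_prop

lemma weight_neg (a40 a22 a04 t : ℝ) (z : ℝ × ℝ) :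
    weight a40 a22 a04 t (-z) = weight a40 a22 a04 t z := by
  simp only [weight, Prod.fst_neg, Prod.snd_neg]
  congr 1
  ring

lemma weight_mono (a40 a22 a04 : ℝ) {s t : ℝ} (h : s ≤ t) (z : ℝ × ℝ) :
    weight a40 a22 a04 s z ≤ weight a40 a22 a04 t z := by
  refine Real.exp_le_exp.2 ?_
  have := mul_le_mul_of_nonneg_right h (add_nonneg (sq_nonneg z.1) (sq_nonneg z.2))
  linarith

lemma isOpen_times (a40 a04 : ℝ) : IsOpen (times a40 a04) := by
  by_cases h : 0 < a40 ∧ 0 < a04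
  · simp [times, h]
  · have : times a40 a04 = Set.Iio 0 := Set.ext fun t => or_iff_right h
    exact this ▸ isOpen_Iio

lemma neg_mul_pow_four_add_le {a : ℝ} (ha : 0 < a) (t u : ℝ) :
    -(a * u ^ 4) + t * u ^ 2 ≤ (t + 1) ^ 2 / (4 * a) - u ^ 2 := by
  have h : (t + 1) ^ 2 / (4 * a) - u ^ 2 - (-(a * u ^ 4) + t * u ^ 2) =
      (2 * a * u ^ 2 - (t + 1)) ^ 2 / (4 * a) := by
    field_simp
    ring
  have : 0 ≤ (2 * a * u ^ 2 - (t + 1)) ^ 2 / (4 * a) := by positivity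
  linarith

/-- The weight is dominated by a Gaussian: through the quartic terms if `a₄₀, a₀₄ > 0`, through the
quadratic ones if `t < 0`. -/
lemma exists_weight_le {a40 a22 a04 t : ℝ} (h40 : 0 ≤ a40) (h22 : 0 ≤ a22) (h04 : 0 ≤ a04)
    (ht : t ∈ times a40 a04) : ∃ b > 0, ∃ C : ℝ, ∀ z : ℝ × ℝ,
      weight a40 a22 a04 t z ≤ C * (Real.exp (-b * z.1 ^ 2) * Real.exp (-b * z.2 ^ 2)) := by
  rcases ht with ⟨hx, hy⟩ | ht
  · refine ⟨1, one_pos, Real.exp ((t + 1) ^ 2 / (4 * a40) + (t + 1) ^ 2 / (4 * a04)),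
      fun z => ?_⟩
    rw [← Real.exp_add, ← Real.exp_add]
    refine Real.exp_le_exp.2 ?_
    have h1 := neg_mul_pow_four_add_le hx t z.1
    have h2 := neg_mul_pow_four_add_le hy t z.2
    have h3 : 0 ≤ a22 * z.1 ^ 2 * z.2 ^ 2 := by positivity
    linarith
  · refine ⟨-t, neg_pos.2 ht, 1, fun z => ?_⟩
    rw [one_mul, ← Real.exp_add]
    refine Real.exp_le_exp.2 ?_
    have h3 : 0 ≤ a40 * z.1 ^ 4 + a22 * z.1 ^ 2 * z.2 ^ 2 + a04 * z.2 ^ 4 := by positivity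
    linarith

lemma integrable_pow_mul_gaussian {b : ℝ} (hb : 0 < b) (h : ℕ) :
    Integrable fun x : ℝ => x ^ h * Real.exp (-b * x ^ 2) := by
  simpa using integrable_rpow_mul_exp_neg_mul_sq hb
    (show (-1 : ℝ) < (h : ℝ) by linarith [(Nat.cast_nonneg h : (0 : ℝ) ≤ h)])

lemma integrable_pow_mul_weight {a40 a22 a04 t : ℝ} (h40 : 0 ≤ a40) (h22 : 0 ≤ a22)
    (h04 : 0 ≤ a04) (ht : t ∈ times a40 a04) (h k : ℕ) :
    Integrable fun z : ℝ × ℝ => z.1 ^ h * z.2 ^ k * weight a40 a22 a04 t z := by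
  obtain ⟨b, hb, C, hC⟩ := exists_weight_le h40 h22 h04 ht
  have hg := ((integrable_pow_mul_gaussian hb h).mul_prod
    (integrable_pow_mul_gaussian hb k)).norm.const_mul C
  refine hg.mono' ?_ (ae_of_all _ fun z => ?_)
  · have := continuous_weight a40 a22 a04 t
    exact Continuous.aestronglyMeasurable (by fun_prop)
  · simp only [norm_mul, Real.norm_eq_abs, Real.abs_exp, abs_of_pos (weight_pos a40 a22 a04 t z)]
    have := mul_le_mul_of_nonneg_left (hC z) (mul_nonneg (abs_nonneg (z.1 ^ h))
      (abs_nonneg (z.2 ^ k)))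
    linarith

/-! ### The moment functional -/

/-- All polynomials are integrable against `W`. -/
def HasMoments (W : ℝ × ℝ → ℝ) : Prop :=
  ∀ f : Poly2, Integrable fun z : ℝ × ℝ => MvPolynomial.eval ![z.1, z.2] f * W z

open Classical in
/-- The functional `f ↦ ∬ f W dx dy` on polynomials; it is set to zero if some moment of `W` does
not exist. -/
def momentFunctional (W : ℝ × ℝ → ℝ) : Poly2 →ₗ[ℝ] ℝ :=
  if hW : HasMoments W then
    { toFun := fun f => ∫ z : ℝ × ℝ, MvPolynomial.eval ![z.1, z.2] f * W z
      map_add' := fun f g => by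
        simp only [map_add, add_mul]
        exact integral_add (hW f) (hW g)
      map_smul' := fun c f => by
        simp only [MvPolynomial.smul_eval, mul_assoc, RingHom.id_apply, smul_eq_mul]
        exact integral_const_mul _ _ }
  else 0

lemma momentFunctional_apply {W : ℝ × ℝ → ℝ} (hW : HasMoments W) (f : Poly2) :
    momentFunctional W f = ∫ z : ℝ × ℝ, MvPolynomial.eval ![z.1, z.2] f * W z := by
  rw [momentFunctional, dif_pos hW]
  rfl

lemma momentFunctional_mul {W : ℝ × ℝ → ℝ} (hW : HasMoments W) (f g : Poly2) :
    momentFunctional W (f * g) = innerProd W f g := by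
  rw [momentFunctional_apply hW, innerProd]
  simp only [map_mul]

lemma continuous_eval_pair (f : Poly2) :
    Continuous fun z : ℝ × ℝ => MvPolynomial.eval ![z.1, z.2] f := by
  refine (MvPolynomial.continuous_eval f).comp (continuous_pi fun i => ?_)
  fin_cases i
  · exact continuous_fst
  · exact continuous_snd

lemma isPositive_momentFunctional {W : ℝ × ℝ → ℝ} (hW : HasMoments W) (hc : Continuous W)
    (hpos : ∀ z, 0 < W z) : IsPositive (momentFunctional W) := by
  intro f hf
  rw [momentFunctional_apply hW]
  rw [integral_pos_iff_support_of_nonneg _ (hW _)]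
  · refine (((continuous_eval_pair (f * f)).mul hc).isOpen_support).measure_pos volume ?_
    by_contra hne
    rw [Set.not_nonempty_iff_eq_empty, Function.support_eq_empty_iff] at hne
    refine hf (MvPolynomial.funext fun v => ?_)
    have hv := congrFun hne (v 0, v 1)
    have hv2 : ![v 0, v 1] = v := by
      ext i
      fin_cases i <;> rfl
    simpa [hv2, (hpos _).ne'] using hv
  · intro z
    simp only [map_mul]
    exact mul_nonneg (mul_self_nonneg _) (hpos z).le

lemma momentFunctional_reflect {W : ℝ × ℝ → ℝ} (hW : HasMoments W) (hsymm : ∀ z, W (-z) = W z)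
    (f : Poly2) : momentFunctional W (reflect f) = momentFunctional W f := by
  rw [momentFunctional_apply hW, momentFunctional_apply hW, ← integral_neg_eq_self]
  refine integral_congr_ae (ae_of_all _ fun z => ?_)
  simp only [hsymm]
  congr 1
  have h : (MvPolynomial.eval ![(-z).1, (-z).2] : Poly2 →+* ℝ).comp (reflect : Poly2 →+* Poly2) =
      MvPolynomial.eval ![z.1, z.2] := by
    refine MvPolynomial.ringHom_ext (fun c => ?_) fun i => ?_
    · simp [reflect]
    · fin_cases i <;> simp [reflect]
  exact RingHom.congr_fun h f

lemma isMonicOrthogonalSystem_iff {W : ℝ × ℝ → ℝ} (hW : HasMoments W) {Q : VecSeq} :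
    IsMonicOrthogonalSystem W Q ↔ IsOrth (momentFunctional W) Q := by
  constructor
  · intro h
    have hm := isMonic_of_leadingMatrix h.system h.monic
    refine ⟨hm, fun n r p hp => hm.orthogonal_lowDegree (fun m hmn k => ?_) hp⟩
    rw [momentFunctional_mul hW]
    exact h.orthogonal n m hmn.ne' r k
  · intro h
    refine ⟨fun n => ⟨fun r => ⟨h.monic.ne_zero n r, h.monic.totalDegree_eq n r⟩,
      h.monic.linearIndependent n⟩, h.monic.leadingMatrix_eq, fun n m hnm r k => ?_⟩
    rw [← momentFunctional_mul hW]
    exact h.orthogonal hnm r k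

lemma hasMoments_weight {a40 a22 a04 t : ℝ} (h40 : 0 ≤ a40) (h22 : 0 ≤ a22) (h04 : 0 ≤ a04)
    (ht : t ∈ times a40 a04) : HasMoments (weight a40 a22 a04 t) := by
  intro f
  induction f using MvPolynomial.induction_on' with
  | monomial u a =>
    refine ((integrable_pow_mul_weight h40 h22 h04 ht (u 0) (u 1)).const_mul a).congr
      (ae_of_all _ fun z => ?_)
    simp only [MvPolynomial.eval_monomial]
    rw [Finsupp.prod_fintype _ _ (by simp), Fin.prod_univ_two]
    simp only [Matrix.cons_val_zero, Matrix.cons_val_one]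
    ring
  | add p q hp hq =>
    simp only [map_add, add_mul]
    exact hp.add hq

/-- Differentiating the moments under the integral sign multiplies by `x² + y²`. Since the weight
increases with `t`, its value at a slightly later time is a dominating function. -/
lemma hasDerivAt_momentFunctional_weight {a40 a22 a04 t : ℝ} (h40 : 0 ≤ a40) (h22 : 0 ≤ a22)
    (h04 : 0 ≤ a04) (ht : t ∈ times a40 a04) (f : Poly2) :
    HasDerivAt (fun s => momentFunctional (weight a40 a22 a04 s) f)
      (momentFunctional (weight a40 a22 a04 t)
        ((MvPolynomial.X 0 ^ 2 + MvPolynomial.X 1 ^ 2) * f)) t := by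
  have hopen := (isOpen_times a40 a04).mem_nhds ht
  obtain ⟨ε, hε, hball⟩ := Metric.nhds_basis_closedBall.mem_iff.1 hopen
  have hT : t + ε ∈ times a40 a04 := hball (by simp [abs_of_pos hε])
  have hmom : ∀ {s}, s ∈ times a40 a04 → HasMoments (weight a40 a22 a04 s) :=
    fun hs => hasMoments_weight h40 h22 h04 hs
  have key := (hasDerivAt_integral_of_dominated_loc_of_deriv_le (μ := volume)
    (F := fun s (z : ℝ × ℝ) => MvPolynomial.eval ![z.1, z.2] f * weight a40 a22 a04 s z)
    (F' := fun s (z : ℝ × ℝ) => MvPolynomial.eval ![z.1, z.2]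
      ((MvPolynomial.X 0 ^ 2 + MvPolynomial.X 1 ^ 2) * f) * weight a40 a22 a04 s z)
    (bound := fun z => ‖MvPolynomial.eval ![z.1, z.2]
      ((MvPolynomial.X 0 ^ 2 + MvPolynomial.X 1 ^ 2) * f) * weight a40 a22 a04 (t + ε) z‖)
    (Metric.closedBall_mem_nhds t hε)
    (Filter.Eventually.of_forall fun s => ((continuous_eval_pair f).mul
      (continuous_weight a40 a22 a04 s)).aestronglyMeasurable)
    (hmom ht f) (hmom ht _).aestronglyMeasurable ?_ (hmom hT _).norm ?_).2
  · rw [momentFunctional_apply (hmom ht)]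
    refine key.congr_of_eventuallyEq ?_
    filter_upwards [hopen] with s hs
    exact momentFunctional_apply (hmom hs) f
  · refine ae_of_all _ fun z s hs => ?_
    have hs2 : s ≤ t + ε := by
      rw [Metric.mem_closedBall, Real.dist_eq] at hs
      linarith [le_abs_self (s - t)]
    rw [norm_mul, norm_mul, Real.norm_of_nonneg (weight_pos a40 a22 a04 _ z).le,
      Real.norm_of_nonneg (weight_pos a40 a22 a04 _ z).le]
    exact mul_le_mul_of_nonneg_left (weight_mono a40 a22 a04 hs2 z) (norm_nonneg _)
  · refine ae_of_all _ fun z s _ => ?_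
    have h1 : HasDerivAt (fun s : ℝ => weight a40 a22 a04 s z)
        (weight a40 a22 a04 s z * (z.1 ^ 2 + z.2 ^ 2)) s := by
      have h2 := ((hasDerivAt_id s).mul_const (z.1 ^ 2 + z.2 ^ 2)).const_add
        (-(a40 * z.1 ^ 4 + a22 * z.1 ^ 2 * z.2 ^ 2 + a04 * z.2 ^ 4))
      rw [one_mul] at h2
      exact h2.exp
    refine (h1.const_mul (MvPolynomial.eval ![z.1, z.2] f)).congr_deriv ?_
    simp only [map_mul, map_add, map_pow, MvPolynomial.eval_X, Matrix.cons_val_zero,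
      Matrix.cons_val_one]
    ring

end Freud

end

theorem theorem2 (a40 a22 a04 : ℝ) (h40 : 0 ≤ a40) (h22 : 0 ≤ a22) (h04 : 0 ≤ a04)
    (hx : 0 < a40 + a22) (hy : 0 < a22 + a04) :
    -- the moments are finite, and the monic orthogonal system and its coefficients exist
    (∀ t ∈ Freud.times a40 a04,
      (∀ h k : ℕ,
        Integrable (fun z : ℝ × ℝ => z.1 ^ h * z.2 ^ k * Freud.weight a40 a22 a04 t z)) ∧
      (∃! Q : Freud.VecSeq, Freud.IsMonicOrthogonalSystem (Freud.weight a40 a22 a04 t) Q) ∧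
      (∀ Q : Freud.VecSeq, Freud.IsMonicOrthogonalSystem (Freud.weight a40 a22 a04 t) Q →
        ∃! E : Freud.CoeffSeq, Freud.IsThreeTerm Q E)) ∧
    -- the 2D Langmuir lattice
    (∀ (Q : ℝ → Freud.VecSeq) (E : ℝ → Freud.CoeffSeq),
      (∀ t ∈ Freud.times a40 a04,
        Freud.IsMonicOrthogonalSystem (Freud.weight a40 a22 a04 t) (Q t) ∧
        Freud.IsThreeTerm (Q t) (E t)) →
      ∀ t ∈ Freud.times a40 a04, ∀ n : ℕ, 1 ≤ n → ∀ (r : Fin (n + 1)) (c : Fin n),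
        HasDerivAt (fun s => Freud.sumE (E s) n r c)
          ((Freud.V (E t) (n + 1) * Freud.sumE (E t) n -
            Freud.sumE (E t) n * Freud.V (E t) n) r c) t) := by
  have hmom : ∀ s ∈ Freud.times a40 a04, Freud.HasMoments (Freud.weight a40 a22 a04 s) :=
    fun s hs => Freud.hasMoments_weight h40 h22 h04 hs
  have hpos : ∀ s ∈ Freud.times a40 a04,
      Freud.IsPositive (Freud.momentFunctional (Freud.weight a40 a22 a04 s)) := fun s hs =>
    Freud.isPositive_momentFunctional (hmom s hs) (Freud.continuous_weight a40 a22 a04 s)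
      (Freud.weight_pos a40 a22 a04 s)
  refine ⟨fun t ht => ⟨Freud.integrable_pow_mul_weight h40 h22 h04 ht, ?_, fun Q hQ => ?_⟩,
    fun Q E hQE t ht n hn r c => ?_⟩
  · refine ⟨_, (Freud.isMonicOrthogonalSystem_iff (hmom t ht)).2 (hpos t ht).isOrth_orthPart,
      fun P hP => ?_⟩
    exact ((Freud.isMonicOrthogonalSystem_iff (hmom t ht)).1 hP).unique (hpos t ht)
      (hpos t ht).isOrth_orthPart
  · rw [Freud.isMonicOrthogonalSystem_iff (hmom t ht)] at hQ
    obtain ⟨E, hE⟩ := hQ.exists_isThreeTerm (hpos t ht)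
      (Freud.momentFunctional_reflect (hmom t ht) (Freud.weight_neg a40 a22 a04 t))
    exact ⟨E, hE, fun E' hE' => hQ.monic.isThreeTerm_unique hE' hE⟩
  · obtain ⟨n, rfl⟩ := Nat.exists_eq_add_of_le' hn
    have hev := (Freud.isOpen_times a40 a04).eventually_mem ht
    have hE := fun i => Freud.hasDerivAt_recurrence
      (Freud.hasDerivAt_momentFunctional_weight h40 h22 h04 ht) (hev.mono hpos)
      (hev.mono fun s hs => (Freud.isMonicOrthogonalSystem_iff (hmom s hs)).1 (hQE s hs).1)
      (hev.mono fun s hs => (hQE s hs).2) n i r c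
    refine ((hE 0).add (hE 1)).congr_deriv ?_
    rw [← Matrix.add_apply, Freud.sumE, Matrix.mul_add, Matrix.add_mul, sub_add_sub_comm]
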